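/- **Theorem (Main Result).** Let $\alpha_1,\dots,\alpha_n\in\mathbb R^n$ be a system of simple roots of a finite reflection group: they are linearly independent, the group $W\le O(n)$ generated by the reflections $s_i$ in the hyperplanes $\alpha_i^{\perp}$ is finite, and every vector normal to the mirror of a reflection in $W$ is a linear combination of the $\alpha_i$ with all coefficients $\ge 0$ or all $\le 0$. Put $S=\{s_1,\dots,s_n\}$; let $W^*=\{w\in W:\det w=1\}$ be the subgroup of rotations and, for $I\subseteq S$, let $W_I=\langle I\rangle$ and let $$C_I=\{x\in\mathbb R^n:\ \langle\alpha_i,x\rangle=0 \text{ if } s_i\in I,\ \ \langle\alpha_i,x\rangle>0 \text{ if } s_i\notin I\}.$$ For each $I\subseteq S$ fix a point $p_I\in C_I$. *Polypolyhedra.* A strut of orbit-type $(W,I,J)$ is an unordered pair $\{a,b\}$ of different points with $a\in Wp_I$, $b\in Wp_J$. The set it generates is $\{\{r(a),r(b)\}: r\in W^*\}$. The valency of a point in a set of struts is the number of struts of that set incident to it. A general polypolyhedron of orbit-type $(W,I,J)$ is a set generated by a strut of that orbit-type in which every endpoint has valency at least $2$; a strut is univalent if one of its two endpoints has valency $1$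 in the set that it generates. Let $P(W,I,J)$ be the number of general polypolyhedra of orbit-type $(W,I,J)$, where two are identified if an element of $W$ maps one onto the other, and let $U(W,I,J)$ be the number of $W$-orbits of univalent struts of orbit-type $(W,I,J)$. *Centralisers.* For $u\in W$ let $C_W(u)$ be the centraliser of $u$ in $W$. For a subgroup $H\le W$ let $\mathrm{Conj}_H(u)$ be the set of all elements of $H$ that are conjugate to $u$ in $W$, and when it is non-empty let $|C_H(u)|$ denote the number $|H|/|\mathrm{Conj}_H(u)|$. (For $H=W$ this is the order of the centraliser of $u$; for $u\in H$ it is the order of the centraliser of $u$ in $H$ if all $W$-conjugates of $u$ in $H$ are conjugate in $H$.) Let $\sqrt{W_I}=\{u\in W: u^2\in W_I\}$. 1. (Heteroorbital case) Let $I\ne J$, and let $u_i$ run through representatives of the conjugacy classes of $W$ that intersect both $W_I$ and $W_J$, one for each such class. Then $$P(W,I,J)=\sum_i\frac{|C_W(u_i)|}{|C_{W_I}(u_i)|\,|C_{W_J}(u_i)|}-U(W,I,J).$$ 2. (Homoorbital case) Let $I=J$, and let $u_i$ and $w_j$ run through representatives of the conjugacy classes of $W$ that intersect $W_I$ and $\sqrt{W_I}$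 respectively, one for each such class. Then $$P(W,I,I)=\frac12\left[\sum_i\frac{|C_W(u_i)|}{|C_{W_I}(u_i)|^2}+\sum_j\frac{|C_W(w_j^2)|}{|C_{W_I}(w_j^2)|\,|C_W(w_j)|}\right]-1-U(W,I,I).$$ -/

import Mathlib

namespace Polypolyhedra

open scoped RealInnerProductSpace

noncomputable section

/-- Euclidean space `ℝⁿ`. -/
abbrev E (n : ℕ) : Type := EuclideanSpace ℝ (Fin n)

/-- The orthogonal group `O(n)`: all linear isometries of `ℝⁿ`. -/
abbrev O (n : ℕ) : Type := E n ≃ₗᵢ[ℝ] E n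

/-- The reflection `s_β` in the hyperplane orthogonal to `β` (used only for `β ≠ 0`). -/
def refl {n : ℕ} (β : E n) : O n := (ℝ ∙ β)ᗮ.reflection

/-- The reflection group `W` generated by the reflections `s_i` in the vectors `α i`. -/
def W {n : ℕ} (α : Fin n → E n) : Subgroup (O n) :=
  Subgroup.closure (Set.range fun i => refl (α i))

/-- `α` is a system of simple roots of a finite reflection group on `ℝⁿ`: the vectors `α i` are
linearly independent, the group `W` they generate is finite, and every root of `W` (every normal
vector of a reflection belonging to `W`) is a linear combination of the `α i` whose coefficients
are all nonnegative or all nonpositive. The `s_i = refl (α i)` are then the simple reflections. -/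
structure IsSimpleSystem {n : ℕ} (α : Fin n → E n) : Prop where
  linearIndependent : LinearIndependent ℝ α
  finite : Finite (W α)
  root_sign : ∀ β : E n, β ≠ 0 → refl β ∈ W α →
    ∃ c : Fin n → ℝ, β = ∑ i, c i • α i ∧ ((∀ i, 0 ≤ c i) ∨ (∀ i, c i ≤ 0))

/-- The standard parabolic subgroup `W_I`, generated by the `s_i` with `i ∈ I`. -/
def parabolic {n : ℕ} (α : Fin n → E n) (I : Set (Fin n)) : Subgroup (W α) :=
  Subgroup.closure {s : W α | ∃ i ∈ I, (s : O n) = refl (α i)}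

/-- The facet `C_I`: on the hyperplane of `s_i` for `i ∈ I`, on its positive side for `i ∉ I`. -/
def facet {n : ℕ} (α : Fin n → E n) (I : Set (Fin n)) : Set (E n) :=
  {x | ∀ i, (i ∈ I → ⟪α i, x⟫ = 0) ∧ (i ∉ I → 0 < ⟪α i, x⟫)}

/-- `w` is a rotation, i.e. belongs to `W^*`. -/
def IsRotation {n : ℕ} {α : Fin n → E n} (w : W α) : Prop :=
  LinearMap.det ((w : O n).toLinearEquiv : E n →ₗ[ℝ] E n) = 1

/-- The action of `W` on unordered pairs of points (segments, given by their two endpoints). -/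
def move {n : ℕ} {α : Fin n → E n} (w : W α) (x : Sym2 (E n)) : Sym2 (E n) :=
  Sym2.map (w : O n) x

theorem move_one {n : ℕ} {α : Fin n → E n} (x : Sym2 (E n)) : move (1 : W α) x = x := by
  induction x with | _ a b => rfl

theorem move_mul {n : ℕ} {α : Fin n → E n} (v w : W α) (x : Sym2 (E n)) :
    move (v * w) x = move v (move w x) := by
  induction x with | _ a b => rfl

/-- The struts with one endpoint in the orbit `W a` and the other in the orbit `W b`: unordered
pairs of two different points. -/
def struts {n : ℕ} (α : Fin n → E n) (a b : E n) : Set (Sym2 (E n)) :=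
  {x | ¬ x.IsDiag ∧ ∃ v w : W α, x = s((v : O n) a, (w : O n) b)}

/-- The set of struts generated by the seed strut `x`: its images under the rotations in `W`. -/
def generated {n : ℕ} (α : Fin n → E n) (x : Sym2 (E n)) : Set (Sym2 (E n)) :=
  {y | ∃ r : W α, IsRotation r ∧ y = move r x}

/-- The valency of the point `v` in a set `Q` of struts: the number of struts incident to it. -/
def valency {n : ℕ} (Q : Set (Sym2 (E n))) (v : E n) : ℕ∞ :=
  {y | y ∈ Q ∧ v ∈ y}.encard

/-- General polypolyhedra with endpoints in the orbits `W a` and `W b`: sets of struts generated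
by a seed strut in which every endpoint is incident to at least two struts. -/
def IsPolypolyhedron {n : ℕ} (α : Fin n → E n) (a b : E n) (Q : Set (Sym2 (E n))) : Prop :=
  (∃ x ∈ struts α a b, Q = generated α x) ∧
    ∀ v : E n, (∃ y ∈ Q, v ∈ y) → 2 ≤ valency Q v

/-- The strut `x` is univalent: one of its endpoints has valency 1 in the set generated by `x`. -/
def IsUnivalent {n : ℕ} (α : Fin n → E n) (x : Sym2 (E n)) : Prop :=
  ∃ v ∈ x, valency (generated α x) v = 1

/-- Two polypolyhedra are equivalent if an element of `W` maps one onto the other. -/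
def polySetoid {n : ℕ} (α : Fin n → E n) (a b : E n) :
    Setoid {Q : Set (Sym2 (E n)) // IsPolypolyhedron α a b Q} where
  r Q Q' := ∃ w : W α, move w '' Q.1 = Q'.1
  iseqv :=
    { refl := fun Q => ⟨1, by simp [move_one]⟩
      symm := by
        rintro Q Q' ⟨w, h⟩
        refine ⟨w⁻¹, ?_⟩
        rw [← h, Set.image_image]
        simp [← move_mul, move_one]
      trans := by
        rintro Q Q' Q'' ⟨w, h⟩ ⟨v, h'⟩
        refine ⟨v * w, ?_⟩
        rw [← h', ← h, Set.image_image]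
        simp [move_mul] }

/-- Two univalent struts are equivalent if an element of `W` maps one to the other. -/
def univalentSetoid {n : ℕ} (α : Fin n → E n) (a b : E n) :
    Setoid {x : Sym2 (E n) // x ∈ struts α a b ∧ IsUnivalent α x} where
  r x y := ∃ w : W α, move w x.1 = y.1
  iseqv :=
    { refl := fun x => ⟨1, move_one _⟩
      symm := by
        rintro x y ⟨w, h⟩
        exact ⟨w⁻¹, by rw [← h, ← move_mul, inv_mul_cancel, move_one]⟩
      trans := by
        rintro x y z ⟨w, h⟩ ⟨v, h'⟩
        exact ⟨v * w, by rw [← h', ← h, move_mul]⟩ }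

/-- `P`: the number of general polypolyhedra with endpoints in `W a` and `W b`, up to `W`. -/
def numPoly {n : ℕ} (α : Fin n → E n) (a b : E n) : ℕ :=
  Nat.card (Quotient (polySetoid α a b))

/-- `U`: the number of univalent struts with endpoints in `W a` and `W b`, up to `W`. -/
def numUnivalent {n : ℕ} (α : Fin n → E n) (a b : E n) : ℕ :=
  Nat.card (Quotient (univalentSetoid α a b))

section Group

variable {G : Type*} [Group G]

/-- The order `|C_G(u)|` of the centraliser of `u` in the whole group. -/
def cent (u : G) : ℚ := Nat.card (Subgroup.centralizer ({u} : Set G))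

/-- `Conj_H(u)`: the elements of the subgroup `H` that are conjugate to `u` in `G`. -/
def conjIn (H : Subgroup G) (u : G) : Set G := {v | v ∈ H ∧ IsConj u v}

/-- `|C_H(u)|`, defined through the class equation `|H| = |Conj_H(u)| |C_H(u)|`. -/
def centIn (H : Subgroup G) (u : G) : ℚ := Nat.card H / (conjIn H u).ncard

/-- `√H`, the set of all `u` with `u² ∈ H`. -/
def sqrtSet (H : Subgroup G) : Set G := {u | u ^ 2 ∈ H}

/-- The union of the conjugacy classes of `G` that intersect `A`. -/
def classHull (A : Set G) : Set G := {u | ∃ a ∈ A, IsConj u a}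

/-- `R` consists of exactly one representative of each conjugacy class of `G` contained in `A`
(used for unions `A` of conjugacy classes). -/
def IsClassReps (R : Finset G) (A : Set G) : Prop :=
  (∀ u ∈ R, u ∈ A) ∧ ∀ a ∈ A, ∃! u, u ∈ R ∧ IsConj u a

end Group

end

end Polypolyhedra

/-!
`W` acts on the struts of a given type. The set generated by a strut is its orbit under the rotation
subgroup, which is normal in `W`; hence `W` permutes the generated sets, and two struts are in the
same `W`-orbit if and only if their generated sets are. As rotations preserve the valencies, a
generated set is a polypolyhedron if and only if its seed is not univalent, so `P + U` is the number
of `W`-orbits of struts.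

If the orbits `W a` and `W b` differ, the struts correspond to the points of `W a × W b`, and
Burnside's lemma averages the product of the permutation characters of the two factors. For a single
orbit with permutation character `N`, the number of struts fixed by `g` is
`(N(g) ^ 2 + N(g ^ 2)) / 2 - N(g)`, and `N` has average `1`. Counting the `g` with `g⁻¹ u g` in the
stabiliser `H` of a point in two ways gives `N(u) = |C_W(u)| / |C_H(u)|`, and the average of a class
function `F` is the sum of `F(u) / |C_W(u)|` over class representatives `u`.

Finally, the closed chamber is a strict fundamental domain whose points have parabolic stabilisers.
If a product of simple reflections ending in `s_i` keeps `x` in the chamber, then `s_i` fixes `x`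
or the product can be shortened, and one concludes by induction on the length.
-/

namespace Polypolyhedra

open MulAction

open scoped RealInnerProductSpace

section PermutationCharacter

variable {G X : Type*} [Group G] [MulAction G X]

theorem ncard_setOf_smul_mem (x : X) (A : Set X) :
    {g : G | g • x ∈ A}.ncard = (A ∩ orbit G x).ncard * Nat.card (stabilizer G x) := by
  set T : Set (G ⧸ stabilizer G x) := ofQuotientStabilizer G x ⁻¹' A
  have himage : A ∩ orbit G x = ofQuotientStabilizer G x '' T := by
    rw [Set.image_preimage_eq_inter_range, ← (Quotient.mk''_surjective).range_comp]
    rfl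
  rw [himage, Set.ncard_image_of_injective _ (injective_ofQuotientStabilizer G x),
    ← Nat.card_coe_set_eq, ← Nat.card_coe_set_eq, mul_comm, ← Nat.card_prod]
  exact Nat.card_congr (QuotientGroup.preimageMkEquivSubgroupProdSet (stabilizer G x) T)

theorem card_fixedBy_mul_card_stabilizer [IsPretransitive G X] (x : X) (u : G) :
    Nat.card (fixedBy X u) * Nat.card (stabilizer G x) =
      (conjIn (stabilizer G x) u).ncard * Nat.card (Subgroup.centralizer {u}) := by
  have hconj : (stabilizer G x : Set G) ∩ orbit (ConjAct G) u = conjIn (stabilizer G x) u := by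
    ext v
    simp only [conjIn, Set.mem_inter_iff, SetLike.mem_coe, ConjAct.mem_orbit_conjAct,
      Set.mem_ofPred_eq, isConj_comm]
  have hinv (g : G) : g • x ∈ fixedBy X u ↔
      ConjAct.toConjAct g⁻¹ • u ∈ (stabilizer G x : Set G) := by
    rw [ConjAct.toConjAct_inv_smul, SetLike.mem_coe, mem_stabilizer_iff, mem_fixedBy, mul_smul,
      mul_smul, inv_smul_eq_iff]
  calc Nat.card (fixedBy X u) * Nat.card (stabilizer G x)
      = {g : G | g • x ∈ fixedBy X u}.ncard := by
        rw [ncard_setOf_smul_mem, orbit_eq_univ, Set.inter_univ, Nat.card_coe_set_eq]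
    _ = {g : ConjAct G | g • u ∈ (stabilizer G x : Set G)}.ncard :=
        Nat.card_congr (((Equiv.inv G).trans ConjAct.toConjAct.toEquiv).subtypeEquiv hinv)
    _ = (conjIn (stabilizer G x) u).ncard * Nat.card (Subgroup.centralizer {u}) := by
        rw [ncard_setOf_smul_mem, hconj, Subgroup.nat_card_centralizer_nat_card_stabilizer]

theorem ncard_setOf_isConj_mul_cent (u : G) :
    ({v : G | IsConj u v}.ncard : ℚ) * cent u = Nat.card G := by
  have hclass : {v : G | IsConj u v} = orbit (ConjAct G) u := by
    ext v
    rw [ConjAct.mem_orbit_conjAct, isConj_comm, Set.mem_ofPred_eq]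
  rw [cent, Subgroup.nat_card_centralizer_nat_card_stabilizer, hclass, ← index_stabilizer]
  exact_mod_cast (stabilizer (ConjAct G) u).index_mul_card

theorem cent_ne_zero [Finite G] (u : G) : cent u ≠ 0 :=
  Nat.cast_ne_zero.2 Nat.card_pos.ne'

theorem card_fixedBy_eq_cent_div_centIn [Finite G] [IsPretransitive G X] (x : X) (u : G) :
    (Nat.card (fixedBy X u) : ℚ) = cent u / centIn (stabilizer G x) u := by
  have hstab : (Nat.card (stabilizer G x) : ℚ) ≠ 0 := Nat.cast_ne_zero.2 Nat.card_pos.ne'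
  rw [centIn, div_div_eq_mul_div, eq_div_iff hstab, mul_comm (cent u), cent]
  exact_mod_cast card_fixedBy_mul_card_stabilizer x u

theorem card_fixedBy_eq_of_isConj {u v : G} (h : IsConj u v) :
    Nat.card (fixedBy X u) = Nat.card (fixedBy X v) := by
  obtain ⟨c, rfl⟩ := isConj_iff.1 h
  rw [← smul_fixedBy, Set.natCard_smul_set]

theorem mem_classHull_stabilizer [IsPretransitive G X] (x : X) {u : G}
    (hu : (fixedBy X u).Nonempty) : u ∈ classHull (stabilizer G x : Set G) := by
  obtain ⟨y, hy⟩ := hu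
  obtain ⟨g, rfl⟩ := exists_smul_eq G x y
  refine ⟨g⁻¹ * u * g, ?_, isConj_iff.2 ⟨g⁻¹, by rw [inv_inv]⟩⟩
  rw [SetLike.mem_coe, mem_stabilizer_iff, mul_smul, mul_smul, hy, inv_smul_smul]

end PermutationCharacter

section ClassSums

variable {G : Type*} [Group G]

theorem sum_eq_card_mul_sum_classReps [Fintype G] {R : Finset G} {A : Set G}
    (hR : IsClassReps R A) {F : G → ℚ} (hF : ∀ u v, IsConj u v → F u = F v)
    (hA : ∀ u, F u ≠ 0 → u ∈ A) :
    ∑ g, F g = Nat.card G * ∑ u ∈ R, F u / cent u := by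
  classical
  have hrep (g : G) : F g = ∑ u ∈ R, if IsConj u g then F u else 0 := by
    by_cases hg : g ∈ A
    · obtain ⟨u, ⟨huR, hug⟩, huniq⟩ := hR.2 g hg
      rw [Finset.sum_eq_single_of_mem u huR fun v hv hvu =>
        if_neg fun hvg => hvu (huniq v ⟨hv, hvg⟩), if_pos hug, hF u g hug]
    · have hFg : F g = 0 := not_imp_comm.1 (hA g) hg
      refine hFg.trans (Finset.sum_eq_zero fun u _ => ?_).symm
      split_ifs with hug
      · rw [hF u g hug, hFg]
      · rfl
  have hclass (u : G) : (∑ g, if IsConj u g then F u else 0) = Nat.card G * (F u / cent u) := by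
    rw [← Finset.sum_filter, Finset.sum_const, nsmul_eq_mul, ← ncard_setOf_isConj_mul_cent u,
      Set.ncard_eq_toFinset_card', Set.toFinset_ofPred, mul_assoc,
      mul_div_cancel₀ _ (cent_ne_zero u)]
  rw [Finset.sum_congr rfl fun g _ => hrep g, Finset.sum_comm, Finset.mul_sum]
  exact Finset.sum_congr rfl fun u _ => hclass u

theorem mem_classHull_sqrtSet_of_sq_mem {H : Subgroup G} {w : G}
    (h : w ^ 2 ∈ classHull (H : Set G)) : w ∈ classHull (sqrtSet H) := by
  obtain ⟨a, ha, hw⟩ := h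
  obtain ⟨c, rfl⟩ := isConj_iff.1 hw
  exact ⟨c * w * c⁻¹, by rwa [← conj_pow] at ha, isConj_iff.2 ⟨c, rfl⟩⟩

end ClassSums

section OrbitCounting

variable {G X Y : Type*} [Group G] [MulAction G X] [MulAction G Y]

theorem card_orbits_eq_of_bijective (f : X →[G] Y) (hf : Function.Bijective f) :
    Nat.card (orbitRel.Quotient G X) = Nat.card (orbitRel.Quotient G Y) := by
  refine Nat.card_congr (Quotient.congr (Equiv.ofBijective f hf) fun x y => ?_)
  simp only [orbitRel_apply, mem_orbit_iff, Equiv.ofBijective_apply, ← map_smul,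
    hf.injective.eq_iff]

theorem sum_card_fixedBy [Fintype G] [Finite X] :
    ∑ g : G, Nat.card (fixedBy X g) = Nat.card (orbitRel.Quotient G X) * Nat.card G := by
  classical
  have := Fintype.ofFinite X
  simp only [Nat.card_eq_fintype_card]
  exact sum_card_fixedBy_eq_card_orbits_mul_card_group G X

theorem sum_card_fixedBy_of_isPretransitive [Fintype G] [IsPretransitive G X] (x : X) :
    ∑ g : G, Nat.card (fixedBy X g) = Nat.card G := by
  have : Finite X := Finite.of_surjective _ (surjective_smul G x)
  have : Nonempty X := ⟨x⟩
  obtain ⟨_⟩ := (pretransitive_iff_unique_quotient_of_nonempty G X).1 ‹_›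
  rw [sum_card_fixedBy, Nat.card_unique, one_mul]

theorem card_orbits_eq_sum_classReps [Finite G] [Finite X] {R : Finset G} {A : Set G}
    (hR : IsClassReps R A) (hA : ∀ u, (fixedBy X u).Nonempty → u ∈ A) :
    (Nat.card (orbitRel.Quotient G X) : ℚ) = ∑ u ∈ R, Nat.card (fixedBy X u) / cent u := by
  have := Fintype.ofFinite G
  have hG : (Nat.card G : ℚ) ≠ 0 := Nat.cast_ne_zero.2 Nat.card_pos.ne'
  have hsum := sum_eq_card_mul_sum_classReps hR (F := fun u => (Nat.card (fixedBy X u) : ℚ))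
    (fun u v huv => by rw [card_fixedBy_eq_of_isConj huv])
    (fun u hu => hA u (Set.nonempty_of_ncard_ne_zero (Nat.cast_ne_zero.1 hu)))
  rw [← Nat.cast_sum, sum_card_fixedBy, Nat.cast_mul, mul_comm] at hsum
  exact mul_left_cancel₀ hG hsum

theorem card_fixedBy_prod (g : G) :
    Nat.card (fixedBy (X × Y) g) = Nat.card (fixedBy X g) * Nat.card (fixedBy Y g) := by
  have hprod : fixedBy (X × Y) g = fixedBy X g ×ˢ fixedBy Y g := by
    ext
    simp only [mem_fixedBy, Set.mem_prod, Prod.ext_iff, Prod.smul_fst, Prod.smul_snd]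
  rw [hprod, Nat.card_congr (Equiv.Set.prod _ _), Nat.card_prod]

theorem card_orbits_prod [Finite G] [IsPretransitive G X] [IsPretransitive G Y] (x : X) (y : Y)
    {R : Finset G} (hR : IsClassReps R
      (classHull (stabilizer G x : Set G) ∩ classHull (stabilizer G y : Set G))) :
    (Nat.card (orbitRel.Quotient G (X × Y)) : ℚ) =
      ∑ u ∈ R, cent u / (centIn (stabilizer G x) u * centIn (stabilizer G y) u) := by
  have : Finite X := Finite.of_surjective _ (surjective_smul G x)
  have : Finite Y := Finite.of_surjective _ (surjective_smul G y)
  rw [card_orbits_eq_sum_classReps hR]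
  · refine Finset.sum_congr rfl fun u _ => ?_
    rw [card_fixedBy_prod, Nat.cast_mul, card_fixedBy_eq_cent_div_centIn x,
      card_fixedBy_eq_cent_div_centIn y, div_mul_div_comm, div_right_comm,
      mul_div_cancel_right₀ _ (cent_ne_zero u)]
  · rintro u ⟨⟨x', y'⟩, hfix⟩
    obtain ⟨hx', hy'⟩ := Prod.ext_iff.1 hfix
    exact ⟨mem_classHull_stabilizer x ⟨x', hx'⟩, mem_classHull_stabilizer y ⟨y', hy'⟩⟩

theorem sum_card_fixedBy_sq [Fintype G] [IsPretransitive G X] (x : X) {R : Finset G}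
    (hR : IsClassReps R (classHull (sqrtSet (stabilizer G x)))) :
    ∑ g : G, (Nat.card (fixedBy X (g ^ 2)) : ℚ) =
      Nat.card G * ∑ w ∈ R, cent (w ^ 2) / (centIn (stabilizer G x) (w ^ 2) * cent w) := by
  rw [sum_eq_card_mul_sum_classReps hR]
  · simp only [card_fixedBy_eq_cent_div_centIn x, div_div]
  · intro u v huv
    rw [card_fixedBy_eq_of_isConj (huv.pow 2)]
  · intro u hu
    exact mem_classHull_sqrtSet_of_sq_mem
      (mem_classHull_stabilizer x (Set.nonempty_of_ncard_ne_zero (Nat.cast_ne_zero.1 hu)))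

end OrbitCounting

section UnorderedPairs

variable {X : Type*}

/-- The graph whose edges are the pairs `{x, y}` with `x ≠ y` that `f` maps to themselves, so that
these pairs can be counted by the degree-sum formula. -/
def invariantPairGraph (f : X → X) : SimpleGraph X where
  Adj x y := x ≠ y ∧ Sym2.map f s(x, y) = s(x, y)
  symm := ⟨fun x y h => ⟨h.1.symm, by simpa only [Sym2.eq_swap] using h.2⟩⟩
  loopless := ⟨fun _ h => h.1 rfl⟩

theorem mem_edgeSet_invariantPairGraph {f : X → X} {z : Sym2 X} :
    z ∈ (invariantPairGraph f).edgeSet ↔ ¬ z.IsDiag ∧ z.map f = z := by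
  induction z with | _ x y
  rw [SimpleGraph.mem_edgeSet, Sym2.mk_isDiag_iff]
  rfl

theorem invariantPairGraph_adj {f : X → X} {x y : X} :
    (invariantPairGraph f).Adj x y ↔ x ≠ y ∧ (f x = x ∧ f y = y ∨ f x = y ∧ f y = x) := by
  change x ≠ y ∧ Sym2.map f s(x, y) = s(x, y) ↔ _
  rw [Sym2.map_mk, Sym2.eq_iff]

variable [Fintype X] [DecidableEq X] (f : X → X) [DecidableRel (invariantPairGraph f).Adj]

/- A fixed point is adjacent to all other fixed points, a point of a 2-cycle to its partner only,
and the remaining points are isolated. -/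
theorem degree_invariantPairGraph (x : X) :
    (invariantPairGraph f).degree x + 2 * (if f x = x then 1 else 0) =
      Finset.card {y | f y = y} * (if f x = x then 1 else 0) + if f (f x) = x then 1 else 0 := by
  rw [SimpleGraph.degree]
  by_cases hx : f x = x
  · have hnbr : insert x ((invariantPairGraph f).neighborFinset x) =
        Finset.filter (fun y => f y = y) Finset.univ := by
      ext y
      simp only [Finset.mem_insert, SimpleGraph.mem_neighborFinset, invariantPairGraph_adj,
        Finset.mem_filter, Finset.mem_univ, true_and]
      grind
    rw [← hnbr, Finset.card_insert_of_notMem (SimpleGraph.notMem_neighborFinset_self _ x), hx,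
      if_pos hx, if_pos rfl]
    ring
  · by_cases hx₂ : f (f x) = x
    · have hnbr : (invariantPairGraph f).neighborFinset x = {f x} := by
        ext y
        simp only [SimpleGraph.mem_neighborFinset, invariantPairGraph_adj, Finset.mem_singleton]
        grind
      simp only [hnbr, Finset.card_singleton, hx, hx₂, if_true, if_false, mul_zero]
      ring
    · have hnbr : (invariantPairGraph f).neighborFinset x = ∅ := by
        ext y
        simp only [SimpleGraph.mem_neighborFinset, invariantPairGraph_adj, Finset.notMem_empty]
        grind
      simp only [hnbr, Finset.card_empty, hx, hx₂, if_false, mul_zero, add_zero]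

theorem two_mul_card_edgeFinset_invariantPairGraph :
    2 * (invariantPairGraph f).edgeFinset.card + 2 * Finset.card {x | f x = x} =
      Finset.card {x | f x = x} ^ 2 + Finset.card {x | f (f x) = x} := by
  have hsum := Finset.sum_congr rfl fun x (_ : x ∈ Finset.univ) => degree_invariantPairGraph f x
  simpa only [Finset.sum_add_distrib, ← Finset.mul_sum, ← Finset.card_filter, ← sq,
    SimpleGraph.sum_degrees_eq_twice_card_edges] using hsum

end UnorderedPairs

section OffDiagonalPairs

variable {G X : Type*} [Group G] [MulAction G X]

/-- The action on unordered pairs induced by the action on points. -/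
instance instMulActionSym2 : MulAction G (Sym2 X) where
  smul g := Sym2.map (g • ·)
  one_smul z := by
    change Sym2.map (fun x => (1 : G) • x) z = z
    simp only [one_smul, Sym2.map_id', id_eq]
  mul_smul g h z := by
    change Sym2.map _ z = Sym2.map _ (Sym2.map _ z)
    simp only [mul_smul, Sym2.map_map, Function.comp_def]

theorem smul_sym2_def (g : G) (z : Sym2 X) : g • z = z.map (g • ·) := rfl

theorem smul_sym2_isDiag_iff (g : G) (z : Sym2 X) : (g • z).IsDiag ↔ z.IsDiag :=
  Sym2.isDiag_map (MulAction.injective g)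

variable (G X) in
/-- The unordered pairs of two different points, with the induced action. -/
def offDiagPairs : SubMulAction G (Sym2 X) where
  carrier := {z | ¬ z.IsDiag}
  smul_mem' g z hz := (smul_sym2_isDiag_iff g z).not.2 hz

theorem mem_offDiagPairs {z : Sym2 X} : z ∈ offDiagPairs G X ↔ ¬ z.IsDiag := Iff.rfl

theorem two_mul_card_fixedBy_offDiagPairs [Finite X] (g : G) :
    2 * Nat.card (fixedBy (offDiagPairs G X) g) + 2 * Nat.card (fixedBy X g) =
      Nat.card (fixedBy X g) ^ 2 + Nat.card (fixedBy X (g ^ 2)) := by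
  classical
  have := Fintype.ofFinite X
  have hedges : Nat.card (fixedBy (offDiagPairs G X) g) =
      (invariantPairGraph (g • · : X → X)).edgeFinset.card := by
    rw [SimpleGraph.edgeFinset, ← Set.ncard_eq_toFinset_card', Nat.card_coe_set_eq,
      ← Set.ncard_image_of_injective _ Subtype.val_injective]
    congr 1
    ext z
    simp only [Set.mem_image, mem_fixedBy, Subtype.exists, exists_and_right, exists_eq_right,
      mem_edgeSet_invariantPairGraph, Subtype.ext_iff, SubMulAction.val_smul, exists_prop,
      mem_offDiagPairs, smul_sym2_def]
  have hcount := two_mul_card_edgeFinset_invariantPairGraph (g • · : X → X)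
  simp only [← Fintype.card_subtype, ← Nat.card_eq_fintype_card, smul_smul, ← sq] at hcount
  rw [hedges]
  exact hcount

theorem card_orbits_offDiagPairs [Finite G] [IsPretransitive G X] (x : X) {R R' : Finset G}
    (hR : IsClassReps R (classHull (stabilizer G x : Set G)))
    (hR' : IsClassReps R' (classHull (sqrtSet (stabilizer G x)))) :
    (Nat.card (orbitRel.Quotient G (offDiagPairs G X)) : ℚ) =
      1 / 2 * ((∑ u ∈ R, cent u / centIn (stabilizer G x) u ^ 2) +
        ∑ w ∈ R', cent (w ^ 2) / (centIn (stabilizer G x) (w ^ 2) * cent w)) - 1 := by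
  have := Fintype.ofFinite G
  have : Finite X := Finite.of_surjective _ (surjective_smul G x)
  have hG : (Nat.card G : ℚ) ≠ 0 := Nat.cast_ne_zero.2 Nat.card_pos.ne'
  have hprod := card_orbits_prod x x (R := R) (by rwa [Set.inter_self])
  simp only [← sq] at hprod
  have hfixed : 2 * ∑ g : G, Nat.card (fixedBy (offDiagPairs G X) g) +
      2 * ∑ g : G, Nat.card (fixedBy X g) =
      ∑ g : G, Nat.card (fixedBy (X × X) g) + ∑ g : G, Nat.card (fixedBy X (g ^ 2)) := by
    simp only [Finset.mul_sum, ← Finset.sum_add_distrib, card_fixedBy_prod, ← sq,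
      two_mul_card_fixedBy_offDiagPairs]
  have hsq := sum_card_fixedBy_sq x hR'
  rw [sum_card_fixedBy_of_isPretransitive x, sum_card_fixedBy, sum_card_fixedBy] at hfixed
  rw [← Nat.cast_sum] at hsq
  apply_fun ((↑) : ℕ → ℚ) at hfixed
  push_cast [hprod] at hfixed hsq
  refine mul_right_cancel₀ hG ?_
  linear_combination hfixed / 2 + hsq / 2

end OffDiagonalPairs

section Reflections

variable {n : ℕ}

theorem refl_apply (β x : E n) : refl β x = x - (2 * (⟪β, x⟫ / ‖β‖ ^ 2)) • β := by
  rw [refl, Submodule.reflection_orthogonal_apply, Submodule.reflection_singleton_apply]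
  simp only [RCLike.ofReal_real_eq_id, id, neg_sub, mul_smul, two_smul]

theorem refl_mul_self (β : E n) : refl β * refl β = 1 :=
  Submodule.reflection_mul_reflection _

theorem refl_smul (β : E n) {c : ℝ} (hc : c ≠ 0) : refl (c • β) = refl β := by
  simp only [refl, Submodule.span_singleton_smul_eq (IsUnit.mk0 c hc)]

theorem refl_map (w : O n) (β : E n) : refl (w β) = w * refl β * w⁻¹ := by
  rw [eq_mul_inv_iff_mul_eq]
  ext1 x
  change refl (w β) (w x) = w (refl β x)
  rw [refl_apply, refl_apply, map_sub, map_smul, w.norm_map, w.inner_map_map]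

theorem refl_eq_self {β x : E n} (h : ⟪β, x⟫ = 0) : refl β x = x :=
  Submodule.reflection_mem_subspace_eq_self (Submodule.mem_orthogonal_singleton_iff_inner_right.2 h)

theorem inner_refl (β x : E n) : ⟪β, refl β x⟫ = -⟪β, x⟫ := by
  have hneg : refl β β = -β := Submodule.reflection_orthogonalComplement_singleton_eq_neg β
  rw [← (refl β).inner_map_map β x, hneg, inner_neg_left, neg_neg]

end Reflections

section SimpleReflections

variable {n : ℕ}

/-- The tautological action of the orthogonal group on `ℝⁿ`, inherited by all its subgroups. -/
noncomputable instance instMulActionE : MulAction (O n) (E n) where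
  smul w x := w x
  one_smul _ := rfl
  mul_smul _ _ _ := rfl

variable (α : Fin n → E n)

/-- The reflection in the simple root `α i`, as an element of the group `W`. -/
noncomputable def simpleRefl (i : Fin n) : W α :=
  ⟨refl (α i), Subgroup.subset_closure (Set.mem_range_self i)⟩

/-- The product of the simple reflections with the indices in a list. -/
noncomputable def wordProd (L : List (Fin n)) : W α :=
  (L.map (simpleRefl α)).prod

variable {α}

theorem smul_def (w : W α) (x : E n) : w • x = (w : O n) x := rfl

theorem simpleRefl_mul_self (i : Fin n) : simpleRefl α i * simpleRefl α i = 1 :=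
  Subtype.ext (refl_mul_self (α i))

theorem wordProd_nil : wordProd α [] = 1 := rfl

theorem wordProd_cons (i : Fin n) (L : List (Fin n)) :
    wordProd α (i :: L) = simpleRefl α i * wordProd α L :=
  List.prod_cons

theorem wordProd_concat (L : List (Fin n)) (i : Fin n) :
    wordProd α (L ++ [i]) = wordProd α L * simpleRefl α i := by
  rw [wordProd, List.map_append, List.prod_append, List.map_singleton, List.prod_singleton,
    wordProd]

theorem exists_wordProd_eq (w : W α) : ∃ L, wordProd α L = w := by
  obtain ⟨w, hw⟩ := w
  induction hw using Subgroup.closure_induction_left with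
  | one => exact ⟨[], rfl⟩
  | mul_left s hs v hv ih =>
    obtain ⟨i, rfl⟩ := hs
    obtain ⟨L, hL⟩ := ih
    exact ⟨i :: L, by rw [wordProd_cons, hL]; rfl⟩
  | inv_mul_cancel s hs v hv ih =>
    obtain ⟨i, rfl⟩ := hs
    obtain ⟨L, hL⟩ := ih
    refine ⟨i :: L, ?_⟩
    rw [wordProd_cons, hL]
    exact Subtype.ext (congrArg (· * v) (eq_inv_of_mul_eq_one_left (refl_mul_self _)))

theorem refl_smul_mem (w : W α) (i : Fin n) : refl (w • α i) ∈ W α := by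
  rw [smul_def, refl_map]
  exact (w * simpleRefl α i * w⁻¹).2

end SimpleReflections

section SimpleSystem

namespace IsSimpleSystem

variable {n : ℕ} {α : Fin n → E n} (hα : IsSimpleSystem α)

include hα

theorem ne_zero (i : Fin n) : α i ≠ 0 :=
  hα.linearIndependent.ne_zero i

theorem smul_ne_zero (w : W α) (i : Fin n) : w • α i ≠ 0 := by
  rw [smul_def]
  exact (map_ne_zero_iff _ (w : O n).injective).2 (hα.ne_zero i)

/-- The simple roots as a basis of `ℝⁿ`; a root `β` is positive if `0 ≤ hα.basis.repr β`. -/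
noncomputable def basis : Module.Basis (Fin n) ℝ (E n) :=
  Module.Basis.mk hα.linearIndependent
    (hα.linearIndependent.span_eq_top_of_card_eq_finrank' (by simp)).ge

theorem basis_apply (i : Fin n) : hα.basis i = α i :=
  Module.Basis.mk_apply ..

theorem repr_simpleRoot (i : Fin n) : hα.basis.repr (α i) = Finsupp.single i 1 := by
  rw [← hα.basis_apply, Module.Basis.repr_self]

theorem repr_nonneg_or_nonpos (w : W α) (i : Fin n) :
    0 ≤ hα.basis.repr (w • α i) ∨ hα.basis.repr (w • α i) ≤ 0 := by
  obtain ⟨c, hc, hsign⟩ := hα.root_sign (w • α i) (hα.smul_ne_zero w i) (refl_smul_mem w i)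
  have hrepr (k : Fin n) : hα.basis.repr (w • α i) k = c k := by
    rw [hc]
    simp only [← hα.basis_apply, Module.Basis.repr_sum_self]
  exact hsign.imp (fun h k => (h k).trans_eq (hrepr k).symm) fun h k => (hrepr k).trans_le (h k)

theorem repr_refl_of_ne {β : E n} {j k : Fin n} (hkj : k ≠ j) :
    hα.basis.repr (refl (α j) β) k = hα.basis.repr β k := by
  rw [refl_apply, map_sub, map_smul, hα.repr_simpleRoot, Finsupp.sub_apply, Finsupp.smul_apply,
    Finsupp.single_eq_of_ne hkj, smul_zero, sub_zero]

theorem eq_smul_of_repr_refl_nonpos {β : E n} {j : Fin n} (hβ : 0 ≤ hα.basis.repr β)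
    (hrefl : hα.basis.repr (refl (α j) β) ≤ 0) : β = hα.basis.repr β j • α j := by
  refine hα.basis.ext_elem fun k => ?_
  rw [map_smul, hα.repr_simpleRoot, Finsupp.smul_single_one]
  obtain rfl | hkj := eq_or_ne k j
  · rw [Finsupp.single_eq_same]
  · rw [Finsupp.single_eq_of_ne hkj]
    exact le_antisymm ((hα.repr_refl_of_ne hkj).symm.trans_le (hrefl k)) (hβ k)

/- If `wordProd α L • α i` first becomes negative on applying the letter `j`, then the root before
that step is a multiple of `α j`, and the letter `j` cancels against the final reflection. -/
theorem repr_wordProd_nonneg_or_exists_shorter (L : List (Fin n)) (i : Fin n) :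
    0 ≤ hα.basis.repr (wordProd α L • α i) ∨
      ∃ M, M.length < L.length ∧ wordProd α L * simpleRefl α i = wordProd α M := by
  induction L with
  | nil =>
    rw [wordProd_nil, one_smul, hα.repr_simpleRoot]
    exact Or.inl (Finsupp.single_nonneg.2 zero_le_one)
  | cons j L ih =>
    obtain hpos | ⟨M, hlt, hM⟩ := ih
    · refine (hα.repr_nonneg_or_nonpos (wordProd α (j :: L)) i).imp_right fun hneg => ?_
      rw [wordProd_cons, mul_smul] at hneg
      have hroot := hα.eq_smul_of_repr_refl_nonpos hpos hneg
      have hcoeff : hα.basis.repr (wordProd α L • α i) j ≠ 0 := fun h =>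
        hα.smul_ne_zero _ i (by rw [hroot, h, zero_smul])
      have hconj : simpleRefl α j = wordProd α L * simpleRefl α i * (wordProd α L)⁻¹ := by
        refine Subtype.ext ((refl_smul (α j) hcoeff).symm.trans ?_)
        rw [← hroot, smul_def, refl_map]
        rfl
      refine ⟨L, Nat.lt_succ_self _, ?_⟩
      rw [wordProd_cons, hconj, inv_mul_cancel_right, mul_assoc, simpleRefl_mul_self, mul_one]
    · exact Or.inr ⟨j :: M, Nat.succ_lt_succ hlt, by
        rw [wordProd_cons, mul_assoc, hM, wordProd_cons]⟩

end IsSimpleSystem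

end SimpleSystem

section Chamber

variable {n : ℕ} {α : Fin n → E n} {I J : Set (Fin n)} {x y : E n}

/-- The closed fundamental chamber, which is the union of the facets. -/
def closedChamber (α : Fin n → E n) : Set (E n) := {x | ∀ i, 0 ≤ ⟪α i, x⟫}

theorem facet_subset_closedChamber : facet α I ⊆ closedChamber α := fun _ hx i =>
  (em (i ∈ I)).elim (fun hi => ((hx i).1 hi).ge) fun hi => ((hx i).2 hi).le

theorem setOf_inner_eq_zero_of_mem_facet (hx : x ∈ facet α I) : {i | ⟪α i, x⟫ = 0} = I :=
  Set.ext fun i => ⟨fun h => by_contra fun hi => ((hx i).2 hi).ne' h, (hx i).1⟩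

theorem simpleRefl_mem_parabolic {i : Fin n} (hi : i ∈ I) : simpleRefl α i ∈ parabolic α I :=
  Subgroup.subset_closure ⟨i, hi, rfl⟩

theorem parabolic_setOf_inner_eq_zero_le_stabilizer (x : E n) :
    parabolic α {i | ⟪α i, x⟫ = 0} ≤ stabilizer (W α) x := by
  refine (Subgroup.closure_le _).2 ?_
  rintro s ⟨i, hi, hs⟩
  rw [SetLike.mem_coe, mem_stabilizer_iff, smul_def, hs, refl_eq_self hi]

namespace IsSimpleSystem

variable (hα : IsSimpleSystem α)

include hα

theorem inner_nonneg {β : E n} (hβ : 0 ≤ hα.basis.repr β) (hx : x ∈ closedChamber α) :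
    0 ≤ ⟪β, x⟫ := by
  rw [← hα.basis.sum_repr β, sum_inner]
  refine Finset.sum_nonneg fun i _ => ?_
  rw [real_inner_smul_left, hα.basis_apply]
  exact mul_nonneg (hβ i) (hx i)

/- If `wordProd α (P ++ [i])` maps `x` into the chamber, then either the word can be shortened, or
`wordProd α P • α i` is positive and pairing it with the image of `x` gives `⟪α i, x⟫ ≤ 0`, so that
the letter `i` fixes `x`. -/
theorem wordProd_mem_parabolic (hx : x ∈ closedChamber α) (L : List (Fin n))
    (hL : wordProd α L • x ∈ closedChamber α) :
    wordProd α L ∈ parabolic α {i | ⟪α i, x⟫ = 0} := by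
  induction hk : L.length using Nat.strong_induction_on generalizing L with
  | _ k ih =>
    subst hk
    obtain rfl | ⟨P, i, rfl⟩ := L.eq_nil_or_concat'
    · exact one_mem _
    rw [wordProd_concat] at hL ⊢
    have hlen : P.length < (P ++ [i]).length := by simp
    obtain hpos | ⟨M, hlt, hM⟩ := hα.repr_wordProd_nonneg_or_exists_shorter P i
    · have hi : ⟪α i, x⟫ = 0 := by
        have hpair := hα.inner_nonneg hpos hL
        rw [mul_smul, smul_def, smul_def, LinearIsometryEquiv.inner_map_map, smul_def,
          simpleRefl, inner_refl] at hpair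
        exact le_antisymm (neg_nonneg.1 hpair) (hx i)
      have hmem := simpleRefl_mem_parabolic (α := α) (I := {i | ⟪α i, x⟫ = 0}) hi
      have hfix : simpleRefl α i • x = x := refl_eq_self hi
      rw [mul_smul, hfix] at hL
      exact mul_mem (ih P.length hlen P hL rfl) hmem
    · rw [hM] at hL ⊢
      exact ih M.length (hlt.trans hlen) M hL rfl

theorem mem_parabolic_of_smul_mem_closedChamber (hx : x ∈ closedChamber α) {w : W α}
    (hw : w • x ∈ closedChamber α) : w ∈ parabolic α {i | ⟪α i, x⟫ = 0} := by
  obtain ⟨L, rfl⟩ := exists_wordProd_eq w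
  exact hα.wordProd_mem_parabolic hx L hw

theorem eq_of_mem_orbit (hx : x ∈ closedChamber α) (hy : y ∈ closedChamber α)
    (h : y ∈ orbit (W α) x) : y = x := by
  obtain ⟨w, rfl⟩ := h
  exact parabolic_setOf_inner_eq_zero_le_stabilizer x
    (hα.mem_parabolic_of_smul_mem_closedChamber hx hy)

theorem stabilizer_eq_parabolic (hx : x ∈ facet α I) : stabilizer (W α) x = parabolic α I := by
  have hchamber := facet_subset_closedChamber hx
  rw [← setOf_inner_eq_zero_of_mem_facet hx]
  refine le_antisymm (fun w hw => ?_) (parabolic_setOf_inner_eq_zero_le_stabilizer x)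
  exact hα.mem_parabolic_of_smul_mem_closedChamber hchamber (by rwa [mem_stabilizer_iff.1 hw])

theorem disjoint_orbit (hx : x ∈ facet α I) (hy : y ∈ facet α J) (hIJ : I ≠ J) :
    Disjoint (orbit (W α) x) (orbit (W α) y) := by
  refine orbit.eq_or_disjoint x y |>.resolve_left fun h => hIJ ?_
  have hyx : y = x := hα.eq_of_mem_orbit (facet_subset_closedChamber hx)
    (facet_subset_closedChamber hy) (h ▸ mem_orbit_self y)
  rw [← setOf_inner_eq_zero_of_mem_facet hx, ← setOf_inner_eq_zero_of_mem_facet hy, hyx]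

end IsSimpleSystem

end Chamber

section Rotations

variable {n : ℕ}

/-- The determinant as a homomorphism on the orthogonal group. -/
noncomputable def detHom (n : ℕ) : O n →* ℝ where
  toFun w := LinearMap.det (w.toLinearEquiv : E n →ₗ[ℝ] E n)
  map_one' := LinearMap.det_id
  map_mul' v w := LinearMap.det_comp (v.toLinearEquiv : E n →ₗ[ℝ] E n) w.toLinearEquiv

/-- The subgroup `W^*` of rotations in `W`. -/
noncomputable def rotations (α : Fin n → E n) : Subgroup (W α) :=
  ((detHom n).comp (W α).subtype).ker

instance normal_rotations (α : Fin n → E n) : (rotations α).Normal :=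
  MonoidHom.normal_ker _

end Rotations

section Valency

open scoped Pointwise

variable {n : ℕ} {α : Fin n → E n} {a b : E n} {x : Sym2 (E n)}

theorem generated_eq_orbit (α : Fin n → E n) (x : Sym2 (E n)) :
    generated α x = orbit (rotations α) x := by
  ext y
  constructor
  · rintro ⟨r, hr, rfl⟩
    exact ⟨⟨r, hr⟩, rfl⟩
  · rintro ⟨r, rfl⟩
    exact ⟨r, r.2, rfl⟩

theorem mem_generated_self (x : Sym2 (E n)) : x ∈ generated α x := by
  rw [generated_eq_orbit]
  exact mem_orbit_self x

theorem generated_eq_of_mem {y : Sym2 (E n)} (hy : y ∈ generated α x) :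
    generated α y = generated α x := by
  rw [generated_eq_orbit] at hy
  rw [generated_eq_orbit, generated_eq_orbit, orbit_eq_iff.2 hy]

theorem exists_smul_eq_of_mem_generated {y : Sym2 (E n)} (hy : y ∈ generated α x) :
    ∃ w : W α, w • x = y := by
  obtain ⟨r, -, rfl⟩ := hy
  exact ⟨r, rfl⟩

theorem generated_smul (w : W α) (x : Sym2 (E n)) :
    generated α (w • x) = w • generated α x := by
  rw [generated_eq_orbit, generated_eq_orbit, smul_orbit_eq_orbit_smul]

theorem smul_mem_smul_sym2_iff (w : W α) {v : E n} : w • v ∈ w • x ↔ v ∈ x := by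
  rw [smul_sym2_def, Sym2.mem_map]
  exact ⟨fun ⟨u, hu, huv⟩ => smul_left_cancel w huv ▸ hu, fun hv => ⟨v, hv, rfl⟩⟩

theorem valency_smul (w : W α) (Q : Set (Sym2 (E n))) (v : E n) :
    valency (w • Q) (w • v) = valency Q v := by
  have himage : {y | y ∈ w • Q ∧ w • v ∈ y} = w • {y | y ∈ Q ∧ v ∈ y} := by
    ext y
    obtain ⟨z, rfl⟩ := MulAction.surjective w y
    simp only [Set.smul_mem_smul_set_iff, Set.mem_ofPred_eq, smul_mem_smul_sym2_iff]
  rw [valency, valency, himage, Set.encard_smul_set]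

theorem IsUnivalent.smul (hx : IsUnivalent α x) (w : W α) : IsUnivalent α (w • x) := by
  obtain ⟨v, hv, hval⟩ := hx
  exact ⟨w • v, (smul_mem_smul_sym2_iff w).2 hv, by rw [generated_smul, valency_smul, hval]⟩

theorem isUnivalent_smul_iff (w : W α) : IsUnivalent α (w • x) ↔ IsUnivalent α x :=
  ⟨fun hx => inv_smul_smul w x ▸ hx.smul w⁻¹, fun hx => hx.smul w⟩

theorem one_le_valency {Q : Set (Sym2 (E n))} {v : E n} (hx : x ∈ Q) (hv : v ∈ x) :
    1 ≤ valency Q v :=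
  Set.one_le_encard_iff_nonempty.2 ⟨x, hx, hv⟩

theorem isPolypolyhedron_generated_iff (hx : x ∈ struts α a b) :
    IsPolypolyhedron α a b (generated α x) ↔ ¬ IsUnivalent α x := by
  constructor
  · rintro ⟨-, hval⟩ ⟨v, hv, hone⟩
    have htwo := hval v ⟨x, mem_generated_self x, hv⟩
    rw [hone] at htwo
    exact absurd htwo (by decide)
  · refine fun huni => ⟨⟨x, hx, rfl⟩, ?_⟩
    rintro v ⟨y, hy, hv⟩
    obtain ⟨w, rfl⟩ := exists_smul_eq_of_mem_generated hy
    have hne : valency (generated α x) v ≠ 1 := fun hone =>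
      (isUnivalent_smul_iff w).not.2 huni ⟨v, hv, by rwa [generated_eq_of_mem hy]⟩
    rw [← one_add_one_eq_two]
    exact Order.add_one_le_of_lt ((one_le_valency hy hv).lt_of_ne hne.symm)

end Valency

section StrutClasses

variable {n : ℕ} {α : Fin n → E n} {a b : E n}

/-- The set `struts α a b`, which is stable under `W`, with the induced action of `W`. -/
def strutAction (α : Fin n → E n) (a b : E n) : SubMulAction (W α) (Sym2 (E n)) where
  carrier := struts α a b
  smul_mem' := by
    rintro w _ ⟨hdiag, u, v, rfl⟩
    exact ⟨(smul_sym2_isDiag_iff w _).not.2 hdiag, w * u, w * v, rfl⟩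

theorem mem_strutAction {x : Sym2 (E n)} :
    x ∈ strutAction α a b ↔ ¬ x.IsDiag ∧ ∃ u ∈ orbit (W α) a, ∃ v ∈ orbit (W α) b, x = s(u, v) := by
  simp only [mem_orbit_iff, exists_exists_eq_and]
  rfl

instance finite_strutAction [Finite (W α)] (a b : E n) : Finite (strutAction α a b) := by
  refine ((Set.finite_range fun w : W α × W α => s(w.1 • a, w.2 • b)).subset ?_).to_subtype
  rintro _ ⟨-, v, w, rfl⟩
  exact ⟨(v, w), rfl⟩

open Classical in
/-- The class of a strut up to `W`: the class of the strut itself if it is univalent, and otherwise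
the class of the polypolyhedron that it generates. -/
noncomputable def strutClass (x : strutAction α a b) :
    Quotient (polySetoid α a b) ⊕ Quotient (univalentSetoid α a b) :=
  if hx : IsUnivalent α x.1 then Sum.inr (Quotient.mk _ ⟨x.1, x.2, hx⟩)
  else Sum.inl (Quotient.mk _
      ⟨generated α x.1, (isPolypolyhedron_generated_iff x.2).2 hx⟩)

theorem strutClass_of_isUnivalent {x : strutAction α a b} (hx : IsUnivalent α x.1) :
    strutClass x = Sum.inr (Quotient.mk _ ⟨x.1, x.2, hx⟩) :=
  dif_pos hx

theorem strutClass_of_not_isUnivalent {x : strutAction α a b} (hx : ¬ IsUnivalent α x.1) :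
    strutClass x = Sum.inl (Quotient.mk _
      ⟨generated α x.1, (isPolypolyhedron_generated_iff x.2).2 hx⟩) :=
  dif_neg hx

theorem strutClass_surjective : Function.Surjective (strutClass (α := α) (a := a) (b := b)) := by
  rintro (⟨Q, hQ⟩ | ⟨x, hx, huni⟩)
  · obtain ⟨x, hx, rfl⟩ := hQ.1
    exact ⟨⟨x, hx⟩, strutClass_of_not_isUnivalent ((isPolypolyhedron_generated_iff hx).1 hQ)⟩
  · exact ⟨⟨x, hx⟩, strutClass_of_isUnivalent huni⟩

theorem strutClass_smul (w : W α) (x : strutAction α a b) : strutClass (w • x) = strutClass x := by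
  by_cases hx : IsUnivalent α x.1
  · rw [strutClass_of_isUnivalent hx, strutClass_of_isUnivalent (x := w • x) (hx.smul w)]
    exact congrArg Sum.inr (Quotient.sound ((univalentSetoid α a b).symm ⟨w, rfl⟩))
  · rw [strutClass_of_not_isUnivalent hx,
      strutClass_of_not_isUnivalent (x := w • x) ((isUnivalent_smul_iff w).not.2 hx)]
    exact congrArg Sum.inl
      (Quotient.sound ((polySetoid α a b).symm ⟨w, (generated_smul w x.1).symm⟩))

theorem strutClass_eq_iff {x y : strutAction α a b} :
    strutClass x = strutClass y ↔ x ∈ orbit (W α) y := by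
  refine ⟨fun h => ?_, fun ⟨w, hw⟩ => hw ▸ strutClass_smul w y⟩
  suffices ∃ w : W α, w • y.1 = x.1 from this.imp fun w hw => Subtype.ext hw
  by_cases hx : IsUnivalent α x.1 <;> by_cases hy : IsUnivalent α y.1
  · rw [strutClass_of_isUnivalent hx, strutClass_of_isUnivalent hy] at h
    exact Quotient.exact (Sum.inr_injective h).symm
  · rw [strutClass_of_isUnivalent hx, strutClass_of_not_isUnivalent hy] at h
    exact absurd h Sum.inr_ne_inl
  · rw [strutClass_of_not_isUnivalent hx, strutClass_of_isUnivalent hy] at h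
    exact absurd h Sum.inl_ne_inr
  · rw [strutClass_of_not_isUnivalent hx, strutClass_of_not_isUnivalent hy] at h
    obtain ⟨w, hw⟩ := Quotient.exact (Sum.inl_injective h).symm
    obtain ⟨z, hz, hzx⟩ := hw.ge (mem_generated_self x.1)
    obtain ⟨r, rfl⟩ := exists_smul_eq_of_mem_generated hz
    exact ⟨w * r, (mul_smul w r y.1).trans hzx⟩

theorem numPoly_add_numUnivalent [Finite (W α)] (a b : E n) :
    numPoly α a b + numUnivalent α a b =
      Nat.card (orbitRel.Quotient (W α) (strutAction α a b)) := by
  have := Finite.of_surjective _ (strutClass_surjective (α := α) (a := a) (b := b))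
  have : Finite (Quotient (polySetoid α a b)) := Finite.sum_left (Quotient (univalentSetoid α a b))
  have : Finite (Quotient (univalentSetoid α a b)) := Finite.sum_right (Quotient (polySetoid α a b))
  have hker : Setoid.ker strutClass = orbitRel (W α) (strutAction α a b) :=
    Setoid.ext fun _ _ => strutClass_eq_iff
  rw [numPoly, numUnivalent, ← Nat.card_sum, orbitRel.Quotient, ← hker]
  exact Nat.card_congr (Setoid.quotientKerEquivOfSurjective _ strutClass_surjective).symm

end StrutClasses

section PolypolyhedronCount

variable {n : ℕ} {α : Fin n → E n} {a b : E n}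

/-- Two points of disjoint orbits span a strut. -/
def strutOfProd (h : Disjoint (orbit (W α) a) (orbit (W α) b)) :
    orbit (W α) a × orbit (W α) b →[W α] strutAction α a b where
  toFun p := ⟨s(p.1.1, p.2.1),
    mem_strutAction.2 ⟨h.ne_of_mem p.1.2 p.2.2, _, p.1.2, _, p.2.2, rfl⟩⟩
  map_smul' _ _ := rfl

theorem strutOfProd_bijective (h : Disjoint (orbit (W α) a) (orbit (W α) b)) :
    Function.Bijective (strutOfProd h) := by
  constructor
  · rintro ⟨u, v⟩ ⟨u', v'⟩ heq
    obtain ⟨hu, hv⟩ | ⟨huv, -⟩ := Sym2.eq_iff.1 (congrArg Subtype.val heq)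
    · exact Prod.ext (Subtype.ext hu) (Subtype.ext hv)
    · exact absurd huv (h.ne_of_mem u.2 v'.2)
  · rintro ⟨x, hx⟩
    obtain ⟨-, u, hu, v, hv, rfl⟩ := mem_strutAction.1 hx
    exact ⟨(⟨u, hu⟩, ⟨v, hv⟩), rfl⟩

/-- Two different points of one orbit span a strut. -/
def strutOfPair (a : E n) :
    offDiagPairs (W α) (orbit (W α) a) →[W α] strutAction α a a where
  toFun z := ⟨z.1.map Subtype.val, by
    obtain ⟨⟨u, v⟩, hz⟩ := z
    exact mem_strutAction.2
      ⟨(Sym2.isDiag_map Subtype.val_injective).not.2 hz, _, u.2, _, v.2, rfl⟩⟩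
  map_smul' w z := by
    obtain ⟨⟨u, v⟩, hz⟩ := z
    rfl

theorem strutOfPair_bijective (a : E n) : Function.Bijective (strutOfPair (α := α) a) := by
  constructor
  · exact fun z z' h => Subtype.ext
      (Sym2.map.injective Subtype.val_injective (congrArg Subtype.val h))
  · rintro ⟨x, hx⟩
    obtain ⟨hdiag, u, hu, v, hv, rfl⟩ := mem_strutAction.1 hx
    exact ⟨⟨s(⟨u, hu⟩, ⟨v, hv⟩), fun h => hdiag (congrArg Subtype.val h)⟩, rfl⟩

theorem stabilizer_mk_mem_orbit_self {G X : Type*} [Group G] [MulAction G X] (x : X) :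
    stabilizer G (⟨x, mem_orbit_self x⟩ : orbit G x) = stabilizer G x := by
  ext g
  rw [mem_stabilizer_iff, mem_stabilizer_iff, Subtype.ext_iff, orbit.coe_smul]

theorem numPoly_of_disjoint_orbit [Finite (W α)]
    (h : Disjoint (orbit (W α) a) (orbit (W α) b)) {R : Finset (W α)}
    (hR : IsClassReps R (classHull (stabilizer (W α) a : Set (W α)) ∩
      classHull (stabilizer (W α) b : Set (W α)))) :
    (numPoly α a b : ℚ) = (∑ u ∈ R, cent u /
      (centIn (stabilizer (W α) a) u * centIn (stabilizer (W α) b) u)) - numUnivalent α a b := by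
  rw [← stabilizer_mk_mem_orbit_self a, ← stabilizer_mk_mem_orbit_self b] at hR ⊢
  rw [← card_orbits_prod _ _ hR, card_orbits_eq_of_bijective _ (strutOfProd_bijective h),
    ← numPoly_add_numUnivalent, Nat.cast_add, add_sub_cancel_right]

theorem numPoly_self [Finite (W α)] {R R' : Finset (W α)}
    (hR : IsClassReps R (classHull (stabilizer (W α) a : Set (W α))))
    (hR' : IsClassReps R' (classHull (sqrtSet (stabilizer (W α) a)))) :
    (numPoly α a a : ℚ) = 1 / 2 * ((∑ u ∈ R, cent u / centIn (stabilizer (W α) a) u ^ 2) +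
      ∑ w ∈ R', cent (w ^ 2) / (centIn (stabilizer (W α) a) (w ^ 2) * cent w)) - 1 -
        numUnivalent α a a := by
  rw [← stabilizer_mk_mem_orbit_self a] at hR hR' ⊢
  rw [← card_orbits_offDiagPairs _ hR hR', card_orbits_eq_of_bijective _ (strutOfPair_bijective a),
    ← numPoly_add_numUnivalent, Nat.cast_add, add_sub_cancel_right]

end PolypolyhedronCount

end Polypolyhedra

theorem mainTheorem1 {n : ℕ} (α : Fin n → Polypolyhedra.E n)
    (hα : Polypolyhedra.IsSimpleSystem α)
    (p : Set (Fin n) → Polypolyhedra.E n)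
    (hp : ∀ K : Set (Fin n), p K ∈ Polypolyhedra.facet α K) :
    (∀ I J : Set (Fin n), I ≠ J →
      ∀ R : Finset (Polypolyhedra.W α),
        Polypolyhedra.IsClassReps R
          (Polypolyhedra.classHull (Polypolyhedra.parabolic α I : Set (Polypolyhedra.W α)) ∩
            Polypolyhedra.classHull (Polypolyhedra.parabolic α J : Set (Polypolyhedra.W α))) →
        (Polypolyhedra.numPoly α (p I) (p J) : ℚ) =
          (∑ u ∈ R, Polypolyhedra.cent u /
            (Polypolyhedra.centIn (Polypolyhedra.parabolic α I) u *
              Polypolyhedra.centIn (Polypolyhedra.parabolic α J) u))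
          - Polypolyhedra.numUnivalent α (p I) (p J)) ∧
    (∀ I : Set (Fin n),
      ∀ R R' : Finset (Polypolyhedra.W α),
        Polypolyhedra.IsClassReps R
          (Polypolyhedra.classHull (Polypolyhedra.parabolic α I : Set (Polypolyhedra.W α))) →
        Polypolyhedra.IsClassReps R'
          (Polypolyhedra.classHull
            (Polypolyhedra.sqrtSet (Polypolyhedra.parabolic α I))) →
        (Polypolyhedra.numPoly α (p I) (p I) : ℚ) =
          (1 / 2 : ℚ) *
            ((∑ u ∈ R, Polypolyhedra.cent u /
                Polypolyhedra.centIn (Polypolyhedra.parabolic α I) u ^ 2) +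
              ∑ w ∈ R', Polypolyhedra.cent (w ^ 2) /
                (Polypolyhedra.centIn (Polypolyhedra.parabolic α I) (w ^ 2) *
                  Polypolyhedra.cent w))
          - 1 - Polypolyhedra.numUnivalent α (p I) (p I)) := by
  have := hα.finite
  have hstab (K : Set (Fin n)) := hα.stabilizer_eq_parabolic (hp K)
  refine ⟨fun I J hIJ R hR => ?_, fun I R R' hR hR' => ?_⟩
  · rw [← hstab I, ← hstab J] at hR ⊢
    exact Polypolyhedra.numPoly_of_disjoint_orbit (hα.disjoint_orbit (hp I) (hp J) hIJ) hR
  · rw [← hstab I] at hR hR' ⊢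
    exact Polypolyhedra.numPoly_self hR hR'
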